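/- **Theorem (CLT on the torus).** Let $\mathbb{T}=\{z\in\mathbb{C}:|z|=1\}$ be the torus, a compact Abelian group under multiplication with identity $e=1$, and let $\arg:\mathbb{T}\to[-\pi,\pi)$ be given by $\arg(e^{ix})=x$ for $-\pi\le x<\pi$. The characters of $\mathbb{T}$ are $\chi_\ell(y)=y^\ell$, $\ell\in\mathbb{Z}$. For a real number $b\ge 0$ let $\psi_b(\chi_\ell)=b\ell^2$, and let $\gamma_{\psi_b}$ be the symmetric Gauss measure on $\mathbb{T}$ belonging to $\psi_b$, i.e. the unique Borel probability measure with $$\int_{\mathbb{T}}\chi_\ell\,\mathrm{d}\gamma_{\psi_b}=e^{-\psi_b(\chi_\ell)/2}=e^{-b\ell^2/2}\qquad\text{for all }\ell\in\mathbb{Z}.$$ Let $\{X_{n,k}:n\in\mathbb{N},\,k=1,\ldots,K_n\}$ be a rowwise independent array of random elements of $\mathbb{T}$ (for each $n$ the elements $X_{n,1},\dots,X_{n,K_n}$ are independent; different rows may live on different probability spaces). Suppose that there exist an element $a\in\mathbb{T}$ and a real number $b\ge 0$ such that, as $n\to\infty$, 1. $\exp\Big\{i\sum_{k=1}^{K_n}\mathrm{E}\arg(X_{n,k})\Big\}\to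 a$, 2. $\sum_{k=1}^{K_n}\mathrm{Var}\arg(X_{n,k})\to b$, 3. $\sum_{k=1}^{K_n}\mathrm{P}(|\arg(X_{n,k})|>\varepsilon)\to 0$ for all $\varepsilon>0$. Then the array is infinitesimal, i.e. $$\lim_{n\to\infty}\max_{1\le k\le K_n}\mathrm{P}(X_{n,k}\in\mathbb{T}\setminus U)=0$$ for every Borel neighbourhood $U$ of $e$, and the row sums with respect to the group operation of $\mathbb{T}$ (the products $X_{n,1}X_{n,2}\cdots X_{n,K_n}$ of complex numbers) converge in distribution: $$\sum_{k=1}^{K_n}X_{n,k}\;\stackrel{\mathcal{D}}{\longrightarrow}\;\delta_a*\gamma_{\psi_b}\qquad\text{as }n\to\infty,$$ where $\delta_a$ is the Dirac measure at $a$ and $*$ is convolution of measures on the group $\mathbb{T}$. -/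

import Mathlib

open MeasureTheory ProbabilityTheory Filter Topology
open scoped NNReal ENNReal

namespace TorusCLT

/-- The torus (Mathlib's `Circle`) carries its Borel sigma-algebra. -/
noncomputable instance instMeasurableSpaceCircle : MeasurableSpace Circle := borel Circle

instance instBorelSpaceCircle : BorelSpace Circle := ⟨rfl⟩

/-- The argument of a point of the torus with values in `[-π, π)`. Mathlib's `Complex.arg` has
values in `(-π, π]`; the two differ only at the point `-1`. -/
noncomputable def arg (y : Circle) : ℝ :=
  if Complex.arg (y : ℂ) = Real.pi then -Real.pi else Complex.arg (y : ℂ)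

theorem arg_mem (y : Circle) : arg y ∈ Set.Ico (-Real.pi) Real.pi := by
  unfold arg
  have h := Complex.arg_mem_Ioc (y : ℂ)
  have hp := Real.pi_pos
  split_ifs with h1
  · exact ⟨le_rfl, by linarith⟩
  · exact ⟨h.1.le, lt_of_le_of_ne h.2 h1⟩

theorem arg_exp {x : ℝ} (h₁ : -Real.pi ≤ x) (h₂ : x < Real.pi) : arg (Circle.exp x) = x := by
  unfold arg
  rcases h₁.eq_or_lt with h | h
  · subst h
    have : Complex.arg (Circle.exp (-Real.pi) : ℂ) = Real.pi := by
      simp [Circle.coe_exp]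
    rw [if_pos this]
  · rw [Circle.arg_exp h h₂.le, if_neg h₂.ne]

/-- The character `y ↦ y ^ l` of the torus, for an integer `l`. -/
noncomputable def chi (l : ℤ) (y : Circle) : ℂ := ((y ^ l : Circle) : ℂ)

/-- The Fourier transform of a measure on the torus; the character group is identified with
the integers through `l ↦ chi l`. -/
noncomputable def fourierTransform (μ : Measure Circle) (l : ℤ) : ℂ := ∫ y, chi l y ∂μ

/-- The quadratic form `b * l ^ 2` on the character group of the torus. -/
noncomputable def psi (b : ℝ≥0) (l : ℤ) : ℝ := (b : ℝ) * (l : ℝ) ^ 2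

theorem continuous_chi (l : ℤ) : Continuous (chi l) :=
  continuous_induced_dom.comp (continuous_zpow l)

/-- A finite measure on the torus is determined by its Fourier transform. -/
theorem ext_of_fourierTransform {μ ν : Measure Circle} [IsFiniteMeasure μ] [IsFiniteMeasure ν]
    (h : ∀ l, fourierTransform μ l = fourierTransform ν l) : μ = ν := by
  have key : ∀ f : C(AddCircle (2 * Real.pi), ℂ),
      ∫ y, f (AddCircle.homeomorphCircle'.symm y) ∂μ
        = ∫ y, f (AddCircle.homeomorphCircle'.symm y) ∂ν := by
    have : Fact (0 < 2 * Real.pi) := ⟨Real.two_pi_pos⟩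
    have int : ∀ (ρ : Measure Circle) [IsFiniteMeasure ρ] (f : C(AddCircle (2 * Real.pi), ℂ)),
        Integrable (fun y => f (AddCircle.homeomorphCircle'.symm y)) ρ := by
      intro ρ _ f
      refine Integrable.of_bound
        (f.continuous.comp (Homeomorph.continuous _)).aestronglyMeasurable ‖f‖ ?_
      exact Eventually.of_forall fun y => f.norm_coe_le_norm _
    have cont : ∀ (ρ : Measure Circle) [IsFiniteMeasure ρ],
        Continuous (fun f : C(AddCircle (2 * Real.pi), ℂ) =>
          ∫ y, f (AddCircle.homeomorphCircle'.symm y) ∂ρ) := by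
      intro ρ _
      refine continuous_iff_continuousAt.2 fun f₀ => ?_
      refine tendsto_integral_filter_of_norm_le_const ?_ ⟨‖f₀‖ + 1, ?_⟩ ?_
      · exact Eventually.of_forall fun f => (int ρ f).aestronglyMeasurable
      · have : ∀ᶠ f : C(AddCircle (2 * Real.pi), ℂ) in 𝓝 f₀, ‖f‖ < ‖f₀‖ + 1 :=
          continuous_norm.continuousAt.eventually (gt_mem_nhds (lt_add_one _))
        filter_upwards [this] with f hf
        exact Eventually.of_forall fun y => (f.norm_coe_le_norm _).trans hf.le
      · exact Eventually.of_forall fun y =>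
          (ContinuousEvalConst.continuous_eval_const _).tendsto f₀
    intro f
    have hf : f ∈ (Submodule.span ℂ (Set.range
        (@fourier (2 * Real.pi)))).topologicalClosure := by
      rw [span_fourier_closure_eq_top]; trivial
    have hcl : IsClosed {f : C(AddCircle (2 * Real.pi), ℂ) |
        ∫ y, f (AddCircle.homeomorphCircle'.symm y) ∂μ
          = ∫ y, f (AddCircle.homeomorphCircle'.symm y) ∂ν} := isClosed_eq (cont μ) (cont ν)
    refine closure_minimal ?_ hcl hf
    intro g hg
    induction hg using Submodule.span_induction with
    | mem g hg =>
      obtain ⟨l, rfl⟩ := hg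
      have e : ∀ y : Circle,
          fourier l (AddCircle.homeomorphCircle'.symm y : AddCircle (2 * Real.pi)) = chi l y := by
        intro y
        obtain ⟨x, rfl⟩ := Circle.exp_surjective y
        rw [← AddCircle.homeomorphCircle'_apply_mk, Homeomorph.symm_apply_apply,
          fourier_apply, AddCircle.toCircle_zsmul, AddCircle.toCircle_apply_mk,
          AddCircle.homeomorphCircle'_apply_mk, div_self Real.two_pi_pos.ne', one_mul, chi]
      have hl := h l
      simp only [fourierTransform] at hl
      simpa only [Set.mem_ofPred_eq, e] using hl
    | zero => simp
    | add f g _ _ hf hg =>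
      simp only [Set.mem_ofPred_eq, ContinuousMap.add_apply] at *
      rw [integral_add (int μ f) (int μ g), integral_add (int ν f) (int ν g), hf, hg]
    | smul c f _ hf =>
      simp only [Set.mem_ofPred_eq, ContinuousMap.smul_apply] at *
      rw [integral_smul, integral_smul, hf]
  refine ext_of_forall_integral_eq_of_IsFiniteMeasure fun f => ?_
  have h2 := key ⟨fun x => ((f (AddCircle.homeomorphCircle' x) : ℝ) : ℂ), by fun_prop⟩
  simp only [ContinuousMap.coe_mk, Homeomorph.apply_symm_apply] at h2
  rw [integral_complex_ofReal, integral_complex_ofReal] at h2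
  exact_mod_cast h2

/-- For every quadratic form `psi b` there is exactly one probability measure on the torus with
Fourier transform `exp (-psi b / 2)`. -/
theorem existsUnique_gauss (b : ℝ≥0) :
    ∃! γ : ProbabilityMeasure Circle,
      ∀ l : ℤ, fourierTransform (γ : Measure Circle) l = ((Real.exp (-(psi b l) / 2) : ℝ) : ℂ) := by
  refine existsUnique_of_exists_of_unique ?_ ?_
  rotate_left
  · rintro ⟨γ₁, i₁⟩ ⟨γ₂, i₂⟩ h₁ h₂
    exact Subtype.ext (ext_of_fourierTransform fun l => (h₁ l).trans (h₂ l).symm)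
  have hm : Measurable (fun x : ℝ => Circle.exp x) := Circle.exp.continuous.measurable
  refine ⟨⟨(gaussianReal 0 b).map (fun x : ℝ => Circle.exp x),
    Measure.isProbabilityMeasure_map hm.aemeasurable⟩, ?_⟩
  · intro l
    have h := charFun_gaussianReal (μ := 0) (v := b) (l : ℝ)
    rw [charFun_apply_real] at h
    simp only [fourierTransform, ProbabilityMeasure.coe_mk]
    rw [integral_map hm.aemeasurable (continuous_chi l).aestronglyMeasurable]
    have e : ∀ x : ℝ, chi l (Circle.exp x) = Complex.exp (((l : ℝ) : ℂ) * x * Complex.I) := by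
      intro x
      simp only [chi, Circle.coe_zpow, Circle.coe_exp]
      rw [← Complex.exp_int_mul]
      push_cast
      ring_nf
    simp only [e]
    rw [h]
    simp only [psi]
    push_cast
    ring_nf

/-- The symmetric Gauss measure on the torus belonging to the quadratic form `psi b`: the unique
probability measure whose Fourier transform is `exp (-psi b / 2)`. -/
noncomputable def gauss (b : ℝ≥0) : ProbabilityMeasure Circle := (existsUnique_gauss b).choose

theorem fourierTransform_gauss (b : ℝ≥0) (l : ℤ) :
    fourierTransform (gauss b : Measure Circle) l = ((Real.exp (-(psi b l) / 2) : ℝ) : ℂ) :=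
  (existsUnique_gauss b).choose_spec.1 l

/-- A rowwise array `X n 0, …, X n (K n - 1)` of random elements of a topological group is
infinitesimal if, for every Borel neighbourhood `U` of the identity, the row maximum of
`P (X n k ∉ U)` tends to zero. -/
def IsInfinitesimal {G : Type*} [Group G] [TopologicalSpace G] [MeasurableSpace G]
    {Ω : ℕ → Type*} [∀ n, MeasurableSpace (Ω n)] (P : ∀ n, Measure (Ω n)) (K : ℕ → ℕ)
    (X : ∀ n, Fin (K n) → Ω n → G) : Prop :=
  ∀ U : Set G, MeasurableSet U → U ∈ 𝓝 (1 : G) →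
    Tendsto (fun n => ⨆ k : Fin (K n), P n {ω | X n k ω ∉ U}) atTop (𝓝 0)

end TorusCLT

/-!
Weak convergence on the torus is detected by Fourier coefficients: the space of probability measures
on a compact space is compact, and a measure on the torus is determined by its Fourier transform
(`tendsto_of_tendsto_fourierTransform`). It remains to compute the limit of the Fourier transform of
the row products at each `l`.

Since `y = exp (i * arg y)`, the Fourier transform at `l` of the law of a row product is
`exp (i * ∑ E arg X) ^ l` times the product of the characteristic functions, at the integer `l`, of
the centred arguments (`fourierTransform_map_prod`). The first factor tends to `chi l a` by the
assumption on the means. The second factor is a question about arrays of uniformly bounded centred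
real random variables `Z` (`tendsto_prod_integral_cexp_centered`). There the Lindeberg replacement
argument applies: the characteristic function of `Z` differs from that of a normal variable with
the same variance by at most a constant times `E |Z| ^ 3`, because of Taylor's formula and
`(E Z ^ 2) ^ 2 ≤ E Z ^ 4 ≤ M * E |Z| ^ 3`. The sum of the third absolute moments over a row tends to
zero (`tendsto_sum_integral_abs_centered_pow_three`): on `|Z| ≤ 3 * δ` it is at most `3 * δ` times
the sum of the variances, and the remainder is at most a constant times the tail sum.

Infinitesimality holds because a row maximum of probabilities is at most the row sum.
-/

namespace TorusCLT

/-! ### Elementary inequalities -/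

theorem norm_prod_sub_prod_le_sum {ι : Type*} (s : Finset ι) (z w : ι → ℂ)
    (hz : ∀ i ∈ s, ‖z i‖ ≤ 1) (hw : ∀ i ∈ s, ‖w i‖ ≤ 1) :
    ‖∏ i ∈ s, z i - ∏ i ∈ s, w i‖ ≤ ∑ i ∈ s, ‖z i - w i‖ := by
  classical
  induction s using Finset.induction_on with
  | empty => simp
  | insert i s hi ih =>
    rw [Finset.prod_insert hi, Finset.prod_insert hi, Finset.sum_insert hi]
    have hzs : ‖∏ j ∈ s, z j‖ ≤ 1 := by
      rw [norm_prod]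
      exact Finset.prod_le_one (fun _ _ => norm_nonneg _)
        fun j hj => hz j (Finset.mem_insert_of_mem hj)
    have ih' := ih (fun j hj => hz j (Finset.mem_insert_of_mem hj))
      (fun j hj => hw j (Finset.mem_insert_of_mem hj))
    calc ‖z i * ∏ j ∈ s, z j - w i * ∏ j ∈ s, w j‖
        = ‖(z i - w i) * ∏ j ∈ s, z j + w i * (∏ j ∈ s, z j - ∏ j ∈ s, w j)‖ := by ring_nf
      _ ≤ ‖z i - w i‖ * ‖∏ j ∈ s, z j‖ + ‖w i‖ * ‖∏ j ∈ s, z j - ∏ j ∈ s, w j‖ := by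
        simpa only [norm_mul] using norm_add_le ((z i - w i) * ∏ j ∈ s, z j)
          (w i * (∏ j ∈ s, z j - ∏ j ∈ s, w j))
      _ ≤ ‖z i - w i‖ * 1 + 1 * ∑ j ∈ s, ‖z j - w j‖ := by
        gcongr
        exact hw i (Finset.mem_insert_self i s)
      _ = _ := by ring

theorem abs_exp_neg_sub_le_sq {s : ℝ} (hs : 0 ≤ s) : |Real.exp (-s) - (1 - s)| ≤ s ^ 2 := by
  rcases le_total s 1 with h | h
  · have := Real.abs_exp_sub_one_sub_id_le (x := -s) (by rwa [abs_neg, abs_of_nonneg hs])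
    rw [neg_sq] at this
    convert this using 2
    ring
  · rw [abs_of_nonneg (by linarith [Real.add_one_le_exp (-s)])]
    have := Real.exp_le_one_iff.2 (neg_nonpos.2 hs)
    nlinarith

theorem norm_cexp_I_mul_sub_le (x : ℝ) :
    ‖Complex.exp (x * Complex.I) - (1 + x * Complex.I - x ^ 2 / 2)‖
      ≤ |x| ^ 3 * Real.exp |x| := by
  have h := Complex.norm_exp_sub_sum_le_norm_mul_exp (x * Complex.I) 3
  have e : ‖(x : ℂ) * Complex.I‖ = |x| := by simp
  rw [e] at h
  convert h using 3
  simp [Finset.sum_range_succ, mul_pow]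
  ring

/-! ### Bounded real random variables -/

section Bounded

variable {Ω : Type*} [MeasurableSpace Ω] {P : Measure Ω} [IsProbabilityMeasure P] {Z : Ω → ℝ}
  {M : ℝ}

theorem integrable_comp_of_abs_le {E : Type*} [NormedAddCommGroup E]
    (hZ : Measurable Z) (hM : ∀ ω, |Z ω| ≤ M) {f : ℝ → E}
    (hf : Continuous f) : Integrable (fun ω => f (Z ω)) P := by
  obtain ⟨C, hC⟩ := (isCompact_Icc (a := -M) (b := M)).exists_bound_of_continuousOn
    hf.continuousOn
  exact Integrable.of_bound (hf.comp_aestronglyMeasurable hZ.aestronglyMeasurable) C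
    (Eventually.of_forall fun ω => hC _ (abs_le.1 (hM ω)))

theorem abs_integral_le_of_abs_le (hM : ∀ ω, |Z ω| ≤ M) : |∫ ω, Z ω ∂P| ≤ M := by
  simpa using norm_integral_le_of_norm_le_const (μ := P) (f := Z)
    (Eventually.of_forall hM)

/-- Bounds the squared variance, which enters through the quadratic term of `Real.exp`, by the third
absolute moment. It follows from `0 ≤ E (Z ^ 2 - v) ^ 2` with `v = E Z ^ 2`. -/
theorem sq_integral_sq_le (hZ : Measurable Z) (hM : ∀ ω, |Z ω| ≤ M) :
    (∫ ω, Z ω ^ 2 ∂P) ^ 2 ≤ M * ∫ ω, |Z ω| ^ 3 ∂P := by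
  have i : ∀ f : ℝ → ℝ, Continuous f → Integrable (fun ω => f (Z ω)) P :=
    fun f hf => integrable_comp_of_abs_le hZ hM hf
  set v := ∫ ω, Z ω ^ 2 ∂P
  have h0 : 0 ≤ ∫ ω, (Z ω ^ 2 - v) ^ 2 ∂P := integral_nonneg fun _ => sq_nonneg _
  have h1 : ∫ ω, (Z ω ^ 2 - v) ^ 2 ∂P ≤ ∫ ω, (M * |Z ω| ^ 3 - 2 * v * Z ω ^ 2 + v ^ 2) ∂P := by
    refine integral_mono (i (fun x => (x ^ 2 - v) ^ 2) (by fun_prop))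
      (i (fun x => M * |x| ^ 3 - 2 * v * x ^ 2 + v ^ 2) (by fun_prop)) fun ω => ?_
    have : |Z ω| * |Z ω| ^ 3 ≤ M * |Z ω| ^ 3 := by gcongr; exact hM ω
    have e : |Z ω| * |Z ω| ^ 3 = Z ω ^ 4 := by
      rw [← pow_succ', Even.pow_abs (by decide)]
    simp only
    nlinarith
  rw [integral_add (i (fun x => M * |x| ^ 3 - 2 * v * x ^ 2) (by fun_prop)) (integrable_const _),
    integral_sub (i (fun x => M * |x| ^ 3) (by fun_prop)) (i (fun x => 2 * v * x ^ 2) (by fun_prop)),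
    integral_const_mul, integral_const_mul, integral_const] at h1
  simp only [probReal_univ, one_smul] at h1
  nlinarith

/-- Splits the third absolute moment according to whether `|Z| ≤ ε`. -/
theorem integral_abs_pow_three_le (hZ : Measurable Z) (hM : ∀ ω, |Z ω| ≤ M) {ε : ℝ}
    (hε : 0 ≤ ε) :
    ∫ ω, |Z ω| ^ 3 ∂P ≤ ε * ∫ ω, Z ω ^ 2 ∂P + M ^ 3 * P.real {ω | ε < |Z ω|} := by
  have hA : MeasurableSet {ω | ε < |Z ω|} := measurableSet_lt measurable_const hZ.abs
  have i1 : Integrable (fun ω => |Z ω| ^ 3) P :=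
    integrable_comp_of_abs_le hZ hM (f := fun x => |x| ^ 3) (by fun_prop)
  have i2 : Integrable (fun ω => ε * Z ω ^ 2) P :=
    integrable_comp_of_abs_le hZ hM (f := fun x => ε * x ^ 2) (by fun_prop)
  have i3 : Integrable ({ω | ε < |Z ω|}.indicator fun _ => M ^ 3) P :=
    (integrable_const _).indicator hA
  have h : ∫ ω, |Z ω| ^ 3 ∂P ≤
      ∫ ω, (ε * Z ω ^ 2 + {ω | ε < |Z ω|}.indicator (fun _ => M ^ 3) ω) ∂P := by
    refine integral_mono i1 (i2.add i3) fun ω => ?_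
    by_cases hω : ε < |Z ω|
    · simp only [Set.indicator, Set.mem_ofPred_eq, hω, if_true]
      have : |Z ω| ^ 3 ≤ M ^ 3 := by gcongr; exact hM ω
      nlinarith [mul_nonneg hε (sq_nonneg (Z ω))]
    · simp only [Set.indicator, Set.mem_ofPred_eq, hω, if_false, add_zero]
      rw [pow_succ', sq_abs]
      gcongr
      exact not_lt.1 hω
  rw [integral_add i2 i3, integral_const_mul, integral_indicator hA, setIntegral_const,
    smul_eq_mul, mul_comm (P.real _)] at h
  exact h

theorem abs_integral_le_add_mul (hZ : Measurable Z) (hM : ∀ ω, |Z ω| ≤ M) {ε : ℝ}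
    (hε : 0 ≤ ε) : |∫ ω, Z ω ∂P| ≤ ε + M * P.real {ω | ε < |Z ω|} := by
  have hA : MeasurableSet {ω | ε < |Z ω|} := measurableSet_lt measurable_const hZ.abs
  have i3 : Integrable ({ω | ε < |Z ω|}.indicator fun _ => M) P :=
    (integrable_const _).indicator hA
  have h : ∫ ω, |Z ω| ∂P ≤ ∫ ω, (ε + {ω | ε < |Z ω|}.indicator (fun _ => M) ω) ∂P := by
    refine integral_mono (integrable_comp_of_abs_le hZ hM (f := fun x => |x|) (by fun_prop))
      ((integrable_const ε).add i3) fun ω => ?_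
    by_cases hω : ε < |Z ω|
    · simp only [Set.indicator, Set.mem_ofPred_eq, hω, if_true]
      linarith [hM ω]
    · simp only [Set.indicator, Set.mem_ofPred_eq, hω, if_false, add_zero]
      exact not_lt.1 hω
  rw [integral_add (integrable_const _) i3, integral_indicator hA, setIntegral_const,
    integral_const, smul_eq_mul, smul_eq_mul, probReal_univ, one_mul, mul_comm (P.real _)] at h
  exact abs_integral_le_integral_abs.trans h

/-- The characteristic function of a bounded centred variable differs from that of the normal variable
with the same variance by at most a constant times the third absolute moment. Both are compared
with the second-order Taylor polynomial. -/
theorem norm_integral_cexp_sub_le (hZ : Measurable Z) (hM : ∀ ω, |Z ω| ≤ M)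
    (h0 : ∫ ω, Z ω ∂P = 0) (t : ℝ) :
    ‖∫ ω, Complex.exp (t * Z ω * Complex.I) ∂P
        - (Real.exp (-(t ^ 2 * ∫ ω, Z ω ^ 2 ∂P) / 2) : ℝ)‖
      ≤ (|t| ^ 3 * Real.exp (|t| * M) + t ^ 4 * M / 4) * ∫ ω, |Z ω| ^ 3 ∂P := by
  have i : ∀ f : ℝ → ℂ, Continuous f → Integrable (fun ω => f (Z ω)) P :=
    fun f hf => integrable_comp_of_abs_le hZ hM hf
  set v := ∫ ω, Z ω ^ 2 ∂P with hv
  have hv0 : 0 ≤ v := integral_nonneg fun _ => sq_nonneg _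
  have taylor : ∫ ω, (1 + t * Z ω * Complex.I - (t * Z ω) ^ 2 / 2 : ℂ) ∂P
      = ((1 - t ^ 2 * v / 2 : ℝ) : ℂ) := by
    have e : ∀ ω, (1 + t * Z ω * Complex.I - (t * Z ω) ^ 2 / 2 : ℂ)
        = 1 + (t * Complex.I) * (Z ω : ℂ) - (t ^ 2 / 2) * ((Z ω ^ 2 : ℝ) : ℂ) := by
      intro ω; push_cast; ring
    simp only [e]
    rw [integral_sub (i (fun x => 1 + (t * Complex.I) * (x : ℂ)) (by fun_prop))
        (i (fun x => (t ^ 2 / 2) * ((x ^ 2 : ℝ) : ℂ)) (by fun_prop)),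
      integral_add (integrable_const _) (i (fun x => (t * Complex.I) * (x : ℂ)) (by fun_prop)),
      integral_const_mul, integral_const_mul, integral_complex_ofReal, integral_complex_ofReal,
      h0, ← hv]
    simp
    ring
  have h1 : ‖∫ ω, Complex.exp (t * Z ω * Complex.I) ∂P - ((1 - t ^ 2 * v / 2 : ℝ) : ℂ)‖
      ≤ |t| ^ 3 * Real.exp (|t| * M) * ∫ ω, |Z ω| ^ 3 ∂P := by
    rw [← taylor, ← integral_sub (i (fun x => Complex.exp (t * x * Complex.I)) (by fun_prop))
      (i (fun x => 1 + t * x * Complex.I - (t * x) ^ 2 / 2) (by fun_prop)), ← integral_const_mul]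
    refine norm_integral_le_of_norm_le (integrable_comp_of_abs_le hZ hM
      (f := fun x => |t| ^ 3 * Real.exp (|t| * M) * |x| ^ 3) (by fun_prop))
      (Eventually.of_forall fun ω => ?_)
    have h := norm_cexp_I_mul_sub_le (t * Z ω)
    push_cast at h
    refine h.trans ?_
    rw [abs_mul, mul_pow]
    have : Real.exp (|t| * |Z ω|) ≤ Real.exp (|t| * M) := by gcongr; exact hM ω
    calc |t| ^ 3 * |Z ω| ^ 3 * Real.exp (|t| * |Z ω|)
        ≤ |t| ^ 3 * |Z ω| ^ 3 * Real.exp (|t| * M) := by gcongr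
      _ = _ := by ring
  have h2 : ‖((1 - t ^ 2 * v / 2 : ℝ) : ℂ) - (Real.exp (-(t ^ 2 * v) / 2) : ℝ)‖
      ≤ t ^ 4 * M / 4 * ∫ ω, |Z ω| ^ 3 ∂P := by
    rw [← Complex.ofReal_sub, Complex.norm_real, Real.norm_eq_abs, abs_sub_comm, neg_div]
    refine (abs_exp_neg_sub_le_sq (by positivity)).trans ?_
    have := mul_le_mul_of_nonneg_left (sq_integral_sq_le (P := P) hZ hM)
      (by positivity : 0 ≤ t ^ 4 / 4)
    rw [← hv] at this
    linarith
  calc _ ≤ _ := norm_sub_le_norm_sub_add_norm_sub _ ((1 - t ^ 2 * v / 2 : ℝ) : ℂ) _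
    _ ≤ _ := add_le_add h1 h2
    _ = _ := by ring

end Bounded

/-! ### Arrays of bounded real random variables -/

section Array

variable {Ω : ℕ → Type*} [∀ n, MeasurableSpace (Ω n)] {P : ∀ n, Measure (Ω n)}
  [∀ n, IsProbabilityMeasure (P n)] {ι : ℕ → Type*} [∀ n, Fintype (ι n)]
  {Y : ∀ n, ι n → Ω n → ℝ} {M b : ℝ}

/-- Lyapunov's condition for third moments, for uniformly bounded arrays: the tail condition makes the
means uniformly small, so that centring does not affect it. -/
theorem tendsto_sum_integral_abs_centered_pow_three (hY : ∀ n k, Measurable (Y n k))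
    (hM : ∀ n k ω, |Y n k ω| ≤ M)
    (hvar : Tendsto (fun n => ∑ k, Var[Y n k; P n]) atTop (𝓝 b))
    (htail : ∀ ε : ℝ, 0 < ε →
      Tendsto (fun n => ∑ k, (P n).real {ω | ε < |Y n k ω|}) atTop (𝓝 0)) :
    Tendsto (fun n => ∑ k, ∫ ω, |Y n k ω - ∫ ω', Y n k ω' ∂P n| ^ 3 ∂P n) atTop (𝓝 0) := by
  have hb : 0 ≤ b := ge_of_tendsto' hvar fun n => Finset.sum_nonneg fun k _ => variance_nonneg _ _
  rw [Metric.tendsto_atTop']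
  intro ε hε
  -- The limit superior of the sum is at most `3 * δ * b`, which is less than `ε` for this `δ`.
  set δ := ε / (3 * (b + 1)) with hδ_def
  have hδ : 0 < δ := by positivity
  have hδb : 3 * δ * b + (2 * M) ^ 3 * 0 < ε := by
    have : 3 * δ * (b + 1) = ε := by rw [hδ_def]; field_simp
    nlinarith
  have ev1 : ∀ᶠ n in atTop, M * ∑ k, (P n).real {ω | δ < |Y n k ω|} < δ := by
    have := (htail δ hδ).const_mul M
    rw [mul_zero] at this
    exact this.eventually (gt_mem_nhds hδ)
  have ev2 := ((hvar.const_mul (3 * δ)).add ((htail δ hδ).const_mul ((2 * M) ^ 3))).eventually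
    (gt_mem_nhds hδb)
  obtain ⟨N, hN⟩ := eventually_atTop.1 (ev1.and ev2)
  refine ⟨N, fun n hn => ?_⟩
  obtain ⟨h1, h2⟩ := hN n hn.le
  rw [Real.dist_eq, sub_zero, abs_of_nonneg
    (Finset.sum_nonneg fun k _ => integral_nonneg fun ω => by positivity)]
  refine lt_of_le_of_lt ?_ h2
  rw [Finset.mul_sum, Finset.mul_sum, ← Finset.sum_add_distrib]
  refine Finset.sum_le_sum fun k _ => ?_
  obtain ⟨ω₀⟩ : Nonempty (Ω n) := nonempty_of_isProbabilityMeasure (P n)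
  have hM0 : 0 ≤ M := (abs_nonneg _).trans (hM n k ω₀)
  set m := ∫ ω', Y n k ω' ∂P n
  have hmM : |m| ≤ M := abs_integral_le_of_abs_le (hM n k)
  -- The means are at most `2 * δ`, so that `3 * δ < |Y - m|` forces `δ < |Y|`.
  have hmδ : |m| ≤ 2 * δ := by
    have h3 := abs_integral_le_add_mul (P := P n) (hY n k) (hM n k) hδ.le
    have h4 : (P n).real {ω | δ < |Y n k ω|} ≤ ∑ k, (P n).real {ω | δ < |Y n k ω|} :=
      Finset.single_le_sum (f := fun k => (P n).real {ω | δ < |Y n k ω|})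
        (fun _ _ => measureReal_nonneg) (Finset.mem_univ k)
    have h5 := mul_le_mul_of_nonneg_left h4 hM0
    linarith
  rw [variance_eq_integral (hY n k).aemeasurable]
  refine (integral_abs_pow_three_le (ε := 3 * δ) ((hY n k).sub_const m) (M := 2 * M)
    (fun ω => ?_) (by positivity)).trans ?_
  · exact (abs_sub _ _).trans (by linarith [hM n k ω])
  · refine add_le_add_right (mul_le_mul_of_nonneg_left
      (measureReal_mono (fun ω hω => ?_) (measure_ne_top _ _)) (by positivity)) _
    have h6 : 3 * δ < |Y n k ω - m| := hω
    have := abs_sub (Y n k ω) m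
    simp only [Set.mem_ofPred_eq]
    linarith

/-- The characteristic functions of the centred row sums converge to that of the normal
distribution. Every factor is replaced by the Gaussian one with the same variance; the sum of the
errors is controlled by the third absolute moments. -/
theorem tendsto_prod_integral_cexp_centered (hY : ∀ n k, Measurable (Y n k))
    (hM : ∀ n k ω, |Y n k ω| ≤ M)
    (hvar : Tendsto (fun n => ∑ k, Var[Y n k; P n]) atTop (𝓝 b))
    (htail : ∀ ε : ℝ, 0 < ε →
      Tendsto (fun n => ∑ k, (P n).real {ω | ε < |Y n k ω|}) atTop (𝓝 0)) (t : ℝ) :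
    Tendsto (fun n => ∏ k, ∫ ω, Complex.exp (t * (Y n k ω - ∫ ω', Y n k ω' ∂P n : ℝ) * Complex.I)
        ∂P n) atTop (𝓝 ((Real.exp (-(t ^ 2 * b) / 2) : ℝ) : ℂ)) := by
  have gauss : Tendsto (fun n => ∏ k, ((Real.exp (-(t ^ 2 * Var[Y n k; P n]) / 2) : ℝ) : ℂ)) atTop
      (𝓝 ((Real.exp (-(t ^ 2 * b) / 2) : ℝ) : ℂ)) := by
    have e : ∀ n, ∏ k, ((Real.exp (-(t ^ 2 * Var[Y n k; P n]) / 2) : ℝ) : ℂ)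
        = ((Real.exp (-(t ^ 2 * ∑ k, Var[Y n k; P n]) / 2) : ℝ) : ℂ) := by
      intro n
      rw [← Complex.ofReal_prod, ← Real.exp_sum, Finset.mul_sum, ← Finset.sum_neg_distrib,
        Finset.sum_div]
    simp only [e]
    refine (Complex.continuous_ofReal.tendsto _).comp ((Real.continuous_exp.tendsto _).comp ?_)
    exact (hvar.const_mul (t ^ 2)).neg.div_const 2
  have h3 := (tendsto_sum_integral_abs_centered_pow_three hY hM hvar htail).const_mul
    (|t| ^ 3 * Real.exp (|t| * (2 * M)) + t ^ 4 * (2 * M) / 4)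
  rw [mul_zero] at h3
  have hdiff := squeeze_zero_norm (fun n => ?_) h3
    (f := fun n =>
      ∏ k, ∫ ω, Complex.exp (t * (Y n k ω - ∫ ω', Y n k ω' ∂P n : ℝ) * Complex.I) ∂P n
        - ∏ k, ((Real.exp (-(t ^ 2 * Var[Y n k; P n]) / 2) : ℝ) : ℂ))
  · simpa using hdiff.add gauss
  refine (norm_prod_sub_prod_le_sum _ _ _ (fun k _ => ?_) fun k _ => ?_).trans ?_
  · have := norm_integral_le_of_norm_le_const (μ := P n) (C := 1)
      (f := fun ω => Complex.exp (t * (Y n k ω - ∫ ω', Y n k ω' ∂P n : ℝ) * Complex.I))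
      (Eventually.of_forall fun ω => by
        rw [← Complex.ofReal_mul, Complex.norm_exp_ofReal_mul_I])
    simpa using this
  · rw [Complex.norm_real, Real.norm_eq_abs, Real.abs_exp, Real.exp_le_one_iff]
    have := variance_nonneg (Y n k) (P n)
    have : 0 ≤ t ^ 2 * Var[Y n k; P n] := by positivity
    linarith
  · rw [Finset.mul_sum]
    refine Finset.sum_le_sum fun k _ => ?_
    have hint : Integrable (Y n k) (P n) :=
      integrable_comp_of_abs_le (hY n k) (hM n k) (f := fun x => x) continuous_id
    have hmM : |∫ ω', Y n k ω' ∂P n| ≤ M := abs_integral_le_of_abs_le (hM n k)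
    rw [variance_eq_integral (hY n k).aemeasurable]
    refine norm_integral_cexp_sub_le ((hY n k).sub_const _)
      (fun ω => (abs_sub _ _).trans (by linarith [hM n k ω])) ?_ t
    rw [integral_sub hint (integrable_const _)]
    simp

end Array

/-! ### The torus -/

theorem measurable_arg : Measurable arg := by
  have hc : Continuous fun y : Circle => (y : ℂ) := by fun_prop
  have h : Measurable fun y : Circle => Complex.arg (y : ℂ) :=
    Complex.measurable_arg.comp hc.measurable
  exact Measurable.ite (measurableSet_eq_fun h measurable_const) measurable_const h

theorem abs_arg_le_pi (y : Circle) : |arg y| ≤ Real.pi :=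
  abs_le.2 ⟨(arg_mem y).1, (arg_mem y).2.le⟩

theorem exp_arg (y : Circle) : Circle.exp (arg y) = y := by
  unfold arg
  split_ifs with h
  -- At `y = -1` the values `-π` and `π` differ by a full period.
  · rw [← Circle.exp_add_two_pi, ← Circle.exp_arg y, h]
    ring_nf
  · exact Circle.exp_arg y

theorem chi_exp (l : ℤ) (x : ℝ) : chi l (Circle.exp x) = Complex.exp (l * x * Complex.I) := by
  simp only [chi, Circle.coe_zpow, Circle.coe_exp, ← Complex.exp_int_mul]
  ring_nf

theorem chi_mul (l : ℤ) (x y : Circle) : chi l (x * y) = chi l x * chi l y := by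
  simp [chi, mul_zpow]

theorem chi_prod {ι : Type*} (l : ℤ) (s : Finset ι) (x : ι → Circle) :
    chi l (∏ i ∈ s, x i) = ∏ i ∈ s, chi l (x i) := by
  classical
  induction s using Finset.induction_on with
  | empty => simp [chi]
  | insert i s hi ih => rw [Finset.prod_insert hi, Finset.prod_insert hi, chi_mul, ih]

theorem fourierTransform_dirac_mconv (a : Circle) (μ : Measure Circle) [SFinite μ] (l : ℤ) :
    fourierTransform (Measure.mconv (Measure.dirac a) μ) l = chi l a * fourierTransform μ l := by
  rw [Measure.dirac_mconv, fourierTransform, fourierTransform,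
    integral_map (by fun_prop) (continuous_chi l).aestronglyMeasurable]
  simp only [chi_mul]
  exact integral_const_mul _ _

/-- Lévy's continuity theorem on the torus. As the torus is compact, so is its space of probability
measures, and the Fourier transform identifies every cluster point with the limit. -/
theorem tendsto_of_tendsto_fourierTransform {α : Type*} {F : Filter α}
    {μs : α → ProbabilityMeasure Circle} {μ : ProbabilityMeasure Circle}
    (h : ∀ l, Tendsto (fun i => fourierTransform (μs i : Measure Circle) l) F
      (𝓝 (fourierTransform (μ : Measure Circle) l))) :
    Tendsto μs F (𝓝 μ) := by
  have hcont : ∀ l, Continuous fun ν : ProbabilityMeasure Circle =>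
      fourierTransform (ν : Measure Circle) l := fun l => by
    refine continuous_iff_continuousAt.2 fun ν => ?_
    exact (ProbabilityMeasure.tendsto_iff_forall_integral_rclike_tendsto ℂ).1 tendsto_id
      (BoundedContinuousFunction.mkOfCompact ⟨chi l, continuous_chi l⟩)
  refine tendsto_nhds_of_unique_mapClusterPt fun ν hν =>
    Subtype.ext (ext_of_fourierTransform (μ := (ν : Measure Circle)) (ν := (μ : Measure Circle))
      fun l => ?_)
  have hc : MapClusterPt (fourierTransform (ν : Measure Circle) l) F
      (fun i => fourierTransform (μs i : Measure Circle) l) :=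
    hν.continuousAt_comp (hcont l).continuousAt
  have : (𝓝 (fourierTransform (ν : Measure Circle) l)
      ⊓ 𝓝 (fourierTransform (μ : Measure Circle) l)).NeBot :=
    hc.clusterPt.neBot.mono (inf_le_inf_left _ (h l))
  exact eq_of_nhds_neBot this

theorem exists_forall_abs_arg_le_imp_mem {U : Set Circle} (hU : U ∈ 𝓝 (1 : Circle)) :
    ∃ ε > 0, ∀ y, |arg y| ≤ ε → y ∈ U := by
  have h : Circle.exp ⁻¹' U ∈ 𝓝 (0 : ℝ) :=
    Circle.exp.continuous.continuousAt.preimage_mem_nhds (by simpa using hU)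
  obtain ⟨ε, hε, hs⟩ := Metric.nhds_basis_closedBall.mem_iff.1 h
  refine ⟨ε, hε, fun y hy => ?_⟩
  have := hs (show arg y ∈ Metric.closedBall 0 ε by simpa using hy)
  rwa [Set.mem_preimage, exp_arg] at this

section Array

variable {Ω : ℕ → Type*} [∀ n, MeasurableSpace (Ω n)] {P : ∀ n, Measure (Ω n)}
  {K : ℕ → ℕ} {X : ∀ n, Fin (K n) → Ω n → Circle}

theorem isInfinitesimal_of_tendsto_sum (htail : ∀ ε : ℝ, 0 < ε → Tendsto
      (fun n => ∑ k : Fin (K n), P n {ω | ε < |arg (X n k ω)|}) atTop (𝓝 0)) :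
    IsInfinitesimal P K X := by
  intro U _ hU
  obtain ⟨ε, hε, h⟩ := exists_forall_abs_arg_le_imp_mem hU
  refine tendsto_of_tendsto_of_tendsto_of_le_of_le tendsto_const_nhds (htail ε hε)
    (fun _ => zero_le) fun n => iSup_le fun k => ?_
  refine (measure_mono fun ω hω => ?_).trans
    (Finset.single_le_sum (f := fun k => P n {ω | ε < |arg (X n k ω)|})
      (fun _ _ => zero_le) (Finset.mem_univ k))
  exact not_le.1 fun hle => hω (h _ hle)

/-- The Fourier transform of a row product, split into the contribution of the means and the
characteristic functions of the centred arguments. -/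
theorem fourierTransform_map_prod (hmeas : ∀ n k, Measurable (X n k))
    (hindep : ∀ n, iIndepFun (X n) (P n)) (n : ℕ) (l : ℤ) :
    fourierTransform ((P n).map fun ω => ∏ k, X n k ω) l
      = Complex.exp (Complex.I * ((∑ k, ∫ ω, arg (X n k ω) ∂P n : ℝ) : ℂ)) ^ l
        * ∏ k, ∫ ω, Complex.exp ((l : ℝ) *
            (arg (X n k ω) - ∫ ω', arg (X n k ω') ∂P n : ℝ) * Complex.I) ∂P n := by
  rw [fourierTransform, integral_map
    (Finset.measurable_fun_prod _ fun k _ => hmeas n k).aemeasurable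
    (continuous_chi l).aestronglyMeasurable]
  simp only [chi_prod]
  rw [(hindep n).integral_fun_prod_comp (f := fun _ => chi l)
    (fun k => (hmeas n k).aemeasurable) (fun _ => (continuous_chi l).aestronglyMeasurable),
    ← Complex.exp_int_mul, Complex.ofReal_sum, Finset.mul_sum, Finset.mul_sum, Complex.exp_sum,
    ← Finset.prod_mul_distrib]
  refine Finset.prod_congr rfl fun k _ => ?_
  rw [← integral_const_mul]
  refine integral_congr_ae (Eventually.of_forall fun ω => ?_)
  simp only
  rw [← Complex.exp_add]
  conv_lhs => rw [← exp_arg (X n k ω), chi_exp]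
  congr 1
  push_cast
  ring

end Array

end TorusCLT

theorem mainTheorem7
    {Ω : ℕ → Type*} [∀ n, MeasurableSpace (Ω n)]
    (P : ∀ n, Measure (Ω n)) [∀ n, IsProbabilityMeasure (P n)]
    (K : ℕ → ℕ) (X : ∀ n, Fin (K n) → Ω n → Circle)
    (hmeas : ∀ n k, Measurable (X n k))
    (hindep : ∀ n, iIndepFun (X n) (P n))
    (a : Circle) (b : ℝ≥0)
    (hmean : Tendsto
      (fun n => Complex.exp (Complex.I *
        ((∑ k : Fin (K n), ∫ ω, TorusCLT.arg (X n k ω) ∂(P n) : ℝ) : ℂ)))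
      atTop (𝓝 (a : ℂ)))
    (hvar : Tendsto
      (fun n => ∑ k : Fin (K n), variance (fun ω => TorusCLT.arg (X n k ω)) (P n))
      atTop (𝓝 (b : ℝ)))
    (htail : ∀ ε : ℝ, 0 < ε → Tendsto
      (fun n => ∑ k : Fin (K n), P n {ω | ε < |TorusCLT.arg (X n k ω)|})
      atTop (𝓝 0)) :
    TorusCLT.IsInfinitesimal P K X ∧
    TendstoInDistribution (fun n ω => ∏ k : Fin (K n), X n k ω) atTop
      (id : Circle → Circle) P
      (Measure.mconv (Measure.dirac a) (TorusCLT.gauss b : Measure Circle)) := by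
  refine ⟨TorusCLT.isInfinitesimal_of_tendsto_sum htail,
    fun n => (Finset.measurable_fun_prod _ fun k _ => hmeas n k).aemeasurable,
    aemeasurable_id, TorusCLT.tendsto_of_tendsto_fourierTransform fun l => ?_⟩
  have htail' : ∀ ε : ℝ, 0 < ε → Tendsto
      (fun n => ∑ k : Fin (K n), (P n).real {ω | ε < |TorusCLT.arg (X n k ω)|})
      atTop (𝓝 0) := fun ε hε => by
    have := (ENNReal.tendsto_toReal ENNReal.zero_ne_top).comp (htail ε hε)
    refine this.congr fun n => ?_
    exact ENNReal.toReal_sum fun k _ => measure_ne_top _ _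
  have h := TorusCLT.tendsto_prod_integral_cexp_centered
    (fun n k => TorusCLT.measurable_arg.comp (hmeas n k))
    (fun n k ω => TorusCLT.abs_arg_le_pi (X n k ω)) hvar htail' l
  have ha : Tendsto (fun n => Complex.exp (Complex.I *
      ((∑ k : Fin (K n), ∫ ω, TorusCLT.arg (X n k ω) ∂(P n) : ℝ) : ℂ)) ^ l)
      atTop (𝓝 (TorusCLT.chi l a)) := by
    simpa [TorusCLT.chi] using hmean.zpow₀ l (Or.inl a.coe_ne_zero)
  simp only [ProbabilityMeasure.coe_mk, Measure.map_id,
    TorusCLT.fourierTransform_map_prod hmeas hindep, TorusCLT.fourierTransform_dirac_mconv,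
    TorusCLT.fourierTransform_gauss, TorusCLT.psi]
  rw [mul_comm (b : ℝ)]
  exact ha.mul h
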